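/- For $n \ge 1$ let $\mathcal{L}_n$ be the set of Littlewood polynomials of degree $n$, i.e. polynomials $a_0 + a_1 z + \dots + a_n z^n$ with all $a_j \in \{-1, 1\}$, $0 \le j \le n$. For a nonzero polynomial $f \in \mathbb{Z}[z]$ let $N(f)$ be the number of complex zeros of $f$ in the open unit disk $\{|z|<1\}$ and $U(f)$ the number of complex zeros of $f$ on the unit circle $\{|z|=1\}$, both counted with multiplicity. For integers $m \ge 1$, $l \ge 0$ let \[ h_{m,l}(z) = (1-z+z^2)\cdot\frac{1-z^{3m}}{1-z^3} + z^{3m} - z^{3m+1}\cdot\frac{1-z^l}{1-z}, \] the polynomial of degree $l+3m$ whose coefficients, starting from the constant term, follow the pattern $(+-+)^m\,+\,(-)^l$ (that is, $m$ copies of $+1,-1,+1$, then one $+1$, then $l$ copies of $-1$). Let $n \ge 2$. For every even integer $k \in [n/2,\, 2n/3]$ and for every odd integer $k \in [3,\, n/2]$ there exist integers $m \ge 1$ and $l \ge 0$ with $l + 3m = n$ such that $h_{m,l} \in \mathcal{L}_n$, $N(h_{m,l}) = k$ and $U(h_{m,l}) = 0$. -/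

import Mathlib

open Polynomial

/-- The set of Littlewood polynomials of degree `n`: integer polynomials
`a_0 + a_1 z + ⋯ + a_n z^n` of degree `n` all of whose `n + 1` coefficients are `-1` or `1`. -/
def littlewoodPolys (n : ℕ) : Set ℤ[X] :=
  {f | f.natDegree = n ∧ ∀ j ≤ n, f.coeff j = -1 ∨ f.coeff j = 1}

open scoped Classical in
/-- `N(f)`: the number of complex zeros of `f` in the open unit disk, counted with multiplicity. -/
noncomputable def numZerosInDisk (f : ℤ[X]) : ℕ :=
  (f.map (Int.castRingHom ℂ)).roots.countP (fun z => ‖z‖ < 1)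

open scoped Classical in
/-- `U(f)`: the number of complex zeros of `f` on the unit circle, counted with multiplicity. -/
noncomputable def numUnimodularZeros (f : ℤ[X]) : ℕ :=
  (f.map (Int.castRingHom ℂ)).roots.countP (fun z => ‖z‖ = 1)

/-- The polynomial with coefficient pattern `(+-+)^m + (-)^l`, constant term first, namely
`(1 - z + z^2) (1 - z^(3m)) / (1 - z^3) + z^(3m) - z^(3m+1) (1 - z^l) / (1 - z)`;
the two quotients are written as the geometric sums
`1 + z^3 + ⋯ + z^(3(m-1))` and `1 + z + ⋯ + z^(l-1)` which they denote. -/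
noncomputable def patternPoly (m l : ℕ) : ℤ[X] :=
  (1 - X + X ^ 2) * ∑ i ∈ Finset.range m, (X ^ 3) ^ i + X ^ (3 * m)
    - X ^ (3 * m + 1) * ∑ j ∈ Finset.range l, X ^ j

/-! Write h for `patternPoly m l` and z = e^{iθ}. Multiplying h by 1 - z^3 leaves three blocks,
whose moduli on the circle are |2cos θ - 1|, 4|cos(θ/2)| and |2cos θ + 1|. For 0 < θ < 2π/3 the
middle block exceeds the sum of the other two; for 2π/3 < θ ≤ π the lowest one does
(`re_eval_pos_of_mid`, `re_eval_pos_of_low`). A direct evaluation covers θ = 2π/3, so the only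
possible zero on the circle is z = 1, where h(1) = m + 1 - l.

On each arc a continuous phase of h therefore stays within π/2 of the explicit linear phase of the
dominating block. Matching the two arcs at 2π/3, and using that h(1) and h(-1) > 0 are real, fixes
the phase change over [0, π] exactly: 2πm if l ≤ m, and 2πm + π if l > m + 1. By conjugation
symmetry this is half the winding, so the argument principle gives N(h) = 2m or 2m + 1. The ranges
of k are those for which l = n - 3m is nonnegative and falls on the required side of m + 1. -/

/-- The first `n` coefficients of `f` are `1` or `-1`, and the others vanish. -/
def HasSignCoeffs (f : ℤ[X]) (n : ℕ) : Prop :=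
  (∀ j < n, f.coeff j = -1 ∨ f.coeff j = 1) ∧ ∀ j, n ≤ j → f.coeff j = 0

/-! ### Sign coefficients under concatenation of blocks -/

namespace HasSignCoeffs

lemma add_X_pow_mul {f g : ℤ[X]} {n k : ℕ} (hf : HasSignCoeffs f n) (hg : HasSignCoeffs g k) :
    HasSignCoeffs (f + X ^ n * g) (n + k) := by
  refine ⟨fun j hj => ?_, fun j hj => ?_⟩
  · rw [coeff_add, coeff_X_pow_mul']
    split_ifs with h
    · rw [hf.2 j h, zero_add]
      exact hg.1 _ (by omega)
    · rw [add_zero]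
      exact hf.1 j (by omega)
  · rw [coeff_add, coeff_X_pow_mul', if_pos (by omega), hf.2 j (by omega), hg.2 _ (by omega),
      zero_add]

lemma zero : HasSignCoeffs 0 0 := ⟨fun j hj => by omega, fun j _ => coeff_zero j⟩

lemma one : HasSignCoeffs 1 1 := by
  refine ⟨fun j hj => ?_, fun j hj => ?_⟩
  · obtain rfl : j = 0 := by omega
    simp
  · rw [coeff_one, if_neg (by omega)]

lemma neg {f : ℤ[X]} {n : ℕ} (hf : HasSignCoeffs f n) : HasSignCoeffs (-f) n := by
  refine ⟨fun j hj => ?_, fun j hj => ?_⟩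
  · rw [coeff_neg]
    rcases hf.1 j hj with h | h <;> simp [h]
  · rw [coeff_neg, hf.2 j hj, neg_zero]

lemma geom_sum (l : ℕ) : HasSignCoeffs (∑ j ∈ Finset.range l, X ^ j) l := by
  induction l with
  | zero => simpa using zero
  | succ l ih =>
    rw [Finset.sum_range_succ]
    simpa using ih.add_X_pow_mul one

lemma one_sub_X_add_X_sq : HasSignCoeffs (1 - X + X ^ 2) 3 := by
  have h := (one.add_X_pow_mul one.neg).add_X_pow_mul one
  simpa [sub_eq_add_neg] using h

lemma mul_geom_sum {f : ℤ[X]} {d : ℕ} (hf : HasSignCoeffs f d) (m : ℕ) :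
    HasSignCoeffs (f * ∑ i ∈ Finset.range m, (X ^ d) ^ i) (d * m) := by
  induction m with
  | zero => simpa using zero
  | succ m ih =>
    rw [Finset.sum_range_succ, mul_add, ← pow_mul, mul_comm f (X ^ (d * m)), mul_add d m 1, mul_one]
    exact ih.add_X_pow_mul hf

lemma mem_littlewoodPolys {f : ℤ[X]} {n : ℕ} (hf : HasSignCoeffs f (n + 1)) :
    f ∈ littlewoodPolys n := by
  refine ⟨natDegree_eq_of_le_of_coeff_ne_zero ?_ ?_, fun j hj => hf.1 j (by omega)⟩
  · exact natDegree_le_iff_coeff_eq_zero.2 fun j hj => hf.2 j (by omega)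
  · rcases hf.1 n (by omega) with h | h <;> simp [h]

end HasSignCoeffs

lemma patternPoly_mem_littlewoodPolys (m l : ℕ) :
    patternPoly m l ∈ littlewoodPolys (l + 3 * m) := by
  have h := ((HasSignCoeffs.one_sub_X_add_X_sq.mul_geom_sum m).add_X_pow_mul
    HasSignCoeffs.one).add_X_pow_mul (HasSignCoeffs.geom_sum l).neg
  apply HasSignCoeffs.mem_littlewoodPolys
  rw [show l + 3 * m + 1 = 3 * m + 1 + l by ring, patternPoly, sub_eq_add_neg, ← mul_neg]
  simpa using h

/-! ### Continuous phases and winding on the unit circle -/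

open Complex in
/-- A continuous choice of argument of `f`, vacuous where `f` vanishes. -/
def IsPhase (f : ℝ → ℂ) (ψ : ℝ → ℝ) : Prop :=
  Continuous ψ ∧ ∀ θ, f θ = ‖f θ‖ * cexp (ψ θ * I)

namespace IsPhase

open Complex

lemma congr {f g : ℝ → ℂ} {φ : ℝ → ℝ} (hf : IsPhase f φ) (h : ∀ θ, g θ = f θ) : IsPhase g φ :=
  ⟨hf.1, fun θ => by rw [h θ]; exact hf.2 θ⟩

lemma mul {f g : ℝ → ℂ} {φ ψ : ℝ → ℝ} (hf : IsPhase f φ) (hg : IsPhase g ψ) :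
    IsPhase (fun θ => f θ * g θ) (fun θ => φ θ + ψ θ) := by
  refine ⟨hf.1.add hg.1, fun θ => ?_⟩
  beta_reduce
  rw [norm_mul, ofReal_mul, ofReal_add, add_mul, Complex.exp_add]
  conv_lhs => rw [hf.2 θ, hg.2 θ]
  ring

lemma abs_mul_cos {f : ℝ → ℂ} {ψ : ℝ → ℝ} (hψ : IsPhase f ψ) {θ r : ℝ} (h : f θ = r) :
    |r| * Real.cos (ψ θ) = r := by
  have h1 := congrArg re (hψ.2 θ)
  rw [re_ofReal_mul, exp_ofReal_mul_I_re, h, ofReal_re, norm_real, Real.norm_eq_abs] at h1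
  exact h1.symm

lemma const (c : ℂ) : IsPhase (fun _ => c) (fun _ => arg c) :=
  ⟨continuous_const, fun _ => (norm_mul_exp_arg_mul_I c).symm⟩

lemma exp_mul_I : IsPhase (fun θ => cexp (θ * I)) (fun θ => θ) :=
  ⟨continuous_id, fun θ => by simp [norm_exp_ofReal_mul_I]⟩

lemma one_sub {g : ℝ → ℂ} (hg : Continuous g) (h : ∀ θ, ‖g θ‖ < 1) :
    IsPhase (fun θ => 1 - g θ) (fun θ => arg (1 - g θ)) := by
  refine ⟨?_, fun θ => (norm_mul_exp_arg_mul_I _).symm⟩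
  refine continuous_iff_continuousAt.2 fun θ => ?_
  have hs : 1 - g θ ∈ slitPlane := by
    rw [sub_eq_add_neg]
    exact mem_slitPlane_of_norm_lt_one (by simpa using h θ)
  exact (continuousAt_arg hs).comp (f := fun θ => 1 - g θ) (by fun_prop)

/-- Factor as e^{iθ}(1 - a e^{-iθ}). The second factor stays in the slit plane, so its principal
argument is continuous and periodic; all the winding comes from e^{iθ}. -/
lemma exists_of_norm_lt_one {a : ℂ} (ha : ‖a‖ < 1) :
    ∃ ψ : ℝ → ℝ, IsPhase (fun θ => cexp (θ * I) - a) ψ ∧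
      ∀ θ, ψ (θ + 2 * Real.pi) = ψ θ + 2 * Real.pi := by
  have h := exp_mul_I.mul (one_sub (g := fun θ : ℝ => a * cexp (-(θ * I))) (by fun_prop)
    (fun θ => by rw [norm_mul, ← neg_mul, ← ofReal_neg, norm_exp_ofReal_mul_I, mul_one]; exact ha))
  refine ⟨_, h.congr fun θ => ?_, fun θ => ?_⟩
  · rw [mul_sub, mul_left_comm, ← Complex.exp_add]
    simp
  · have : cexp (-(((θ + 2 * Real.pi : ℝ) : ℂ) * I)) = cexp (-(θ * I)) := by
      rw [Complex.exp_neg, Complex.exp_neg, ofReal_add, add_mul, Complex.exp_add]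
      simp
    simp only [this]
    ring

/-- Factor as -a(1 - a⁻¹e^{iθ}): here neither factor winds around 0. -/
lemma exists_of_one_lt_norm {a : ℂ} (ha : 1 < ‖a‖) :
    ∃ ψ : ℝ → ℝ, IsPhase (fun θ => cexp (θ * I) - a) ψ ∧
      ∀ θ, ψ (θ + 2 * Real.pi) = ψ θ := by
  have h := (const (-a)).mul (one_sub (g := fun θ : ℝ => a⁻¹ * cexp (θ * I)) (by fun_prop)
    (fun θ => by
      rw [norm_mul, norm_exp_ofReal_mul_I, mul_one, norm_inv]; exact inv_lt_one_of_one_lt₀ ha))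
  have ha0 : a ≠ 0 := by
    rintro rfl
    norm_num at ha
  refine ⟨_, h.congr fun θ => ?_, fun θ => ?_⟩
  · field_simp
    ring
  · have : cexp (((θ + 2 * Real.pi : ℝ) : ℂ) * I) = cexp (θ * I) := by
      rw [ofReal_add, add_mul, Complex.exp_add]
      simp
    simp only [this]

open scoped Classical in
lemma exists_multiset_prod (s : Multiset ℂ) (hs : ∀ a ∈ s, ‖a‖ ≠ 1) :
    ∃ ψ : ℝ → ℝ, IsPhase (fun θ => (s.map fun a => cexp (θ * I) - a).prod) ψ ∧
      ∀ θ, ψ (θ + 2 * Real.pi) = ψ θ + 2 * Real.pi * (s.countP fun a => ‖a‖ < 1) := by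
  induction s using Multiset.induction_on with
  | empty => exact ⟨fun _ => 0, ⟨continuous_const, by simp⟩, by simp⟩
  | cons a s ih =>
    obtain ⟨ψ, hψ, hψ'⟩ := ih fun b hb => hs b (Multiset.mem_cons_of_mem hb)
    rcases lt_or_gt_of_ne (hs a (Multiset.mem_cons_self a s)) with ha | ha
    · obtain ⟨φ, hφ, hφ'⟩ := exists_of_norm_lt_one ha
      refine ⟨_, by simpa only [Multiset.map_cons, Multiset.prod_cons] using hφ.mul hψ,
        fun θ => ?_⟩
      rw [hφ', hψ', Multiset.countP_cons_of_pos (p := fun a : ℂ => ‖a‖ < 1) _ ha]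
      push_cast
      ring
    · obtain ⟨φ, hφ, hφ'⟩ := exists_of_one_lt_norm ha
      refine ⟨_, by simpa only [Multiset.map_cons, Multiset.prod_cons] using hφ.mul hψ,
        fun θ => ?_⟩
      rw [hφ', hψ', Multiset.countP_cons_of_neg (p := fun a : ℂ => ‖a‖ < 1) _ ha.not_gt]
      ring

open scoped Classical in
/-- The argument principle for polynomials on the unit circle. -/
lemma exists_polynomial (p : ℂ[X]) (hp : ∀ z, ‖z‖ = 1 → p.eval z ≠ 0) :
    ∃ ψ : ℝ → ℝ, IsPhase (fun θ => p.eval (cexp (θ * I))) ψ ∧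
      ∀ θ, ψ (θ + 2 * Real.pi) = ψ θ + 2 * Real.pi * (p.roots.countP fun a => ‖a‖ < 1) := by
  obtain ⟨ψ, hψ, hψ'⟩ := exists_multiset_prod p.roots
    fun a ha h => hp a h (isRoot_of_mem_roots ha)
  refine ⟨_, ((const p.leadingCoeff).mul hψ).congr fun θ => ?_, fun θ => ?_⟩
  · conv_lhs => rw [(IsAlgClosed.splits p).eq_prod_roots]
    rw [eval_mul, eval_C, eval_multiset_prod, Multiset.map_map]
    simp
  · rw [hψ']
    ring

/-- A phase that stays within a right angle of `0` modulo `2π` stays near one multiple of `2π`. -/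
lemma exists_int_of_cos_pos {β : ℝ → ℝ} (hβ : Continuous β) {a b : ℝ} (hab : a < b)
    (h : ∀ t ∈ Set.Ioo a b, 0 < Real.cos (β t)) :
    ∃ j : ℤ, ∀ t ∈ Set.Icc a b, |β t - 2 * Real.pi * j| ≤ Real.pi / 2 := by
  have hpi := Real.pi_pos
  obtain ⟨t₀, ht₀⟩ := Set.nonempty_Ioo.2 hab
  have hcos : ∀ (j : ℤ) (t : ℝ), Real.cos |β t - 2 * Real.pi * j| = Real.cos (β t) := by
    intro j t
    rw [Real.cos_abs, mul_comm, Real.cos_sub_int_mul_two_pi]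
  set j := round (β t₀ / (2 * Real.pi)) with hj
  refine ⟨j, ?_⟩
  have h0 : |β t₀ - 2 * Real.pi * j| < Real.pi / 2 := by
    by_contra! hc
    have h1 : |β t₀ - 2 * Real.pi * j| ≤ Real.pi := by
      have h2 := abs_sub_round (β t₀ / (2 * Real.pi))
      have h3 : β t₀ - 2 * Real.pi * j = 2 * Real.pi * (β t₀ / (2 * Real.pi) - j) := by
        field_simp
      rw [h3, abs_mul, abs_of_pos (by positivity : 0 < 2 * Real.pi)]
      nlinarith
    have h4 := Real.cos_nonpos_of_pi_div_two_le_of_le hc (by linarith)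
    rw [hcos] at h4
    exact absurd (h t₀ ht₀) h4.not_gt
  -- Leaving the band would, by the intermediate value theorem, force distance exactly π/2
  -- somewhere, where the cosine vanishes.
  have hopen : Set.Ioo a b ⊆ {t | |β t - 2 * Real.pi * j| ≤ Real.pi / 2} := by
    intro t ht
    by_contra hc
    rw [Set.mem_ofPred_eq, not_le] at hc
    obtain ⟨s, hs, hs'⟩ := isPreconnected_Ioo.intermediate_value ht₀ ht
      (f := fun t => |β t - 2 * Real.pi * j|) (by fun_prop) ⟨h0.le, hc.le⟩
    have h5 := h s hs
    beta_reduce at hs'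
    rw [← hcos j, hs', Real.cos_pi_div_two] at h5
    exact lt_irrefl _ h5
  -- The weak bound passes to the endpoints, where positivity of the cosine is not assumed.
  rw [← closure_Ioo hab.ne]
  exact closure_minimal hopen (isClosed_le (f := fun t => |β t - 2 * Real.pi * j|) (by fun_prop)
    continuous_const)

/-- A function with `f (-θ) = conj (f θ)` collects half of its winding on `[0, π]`. -/
lemma sub_eq_pi_mul {f : ℝ → ℂ} {ψ : ℝ → ℝ} (hψ : IsPhase f ψ) (hf : ∀ θ, f θ ≠ 0)
    (hconj : ∀ θ, f (-θ) = (starRingEnd ℂ) (f θ)) {N : ℕ}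
    (hN : ∀ θ, ψ (θ + 2 * Real.pi) = ψ θ + 2 * Real.pi * N) :
    ψ Real.pi - ψ 0 = Real.pi * N := by
  have hpi := Real.pi_pos
  have hexp : ∀ θ, cexp ((ψ θ + ψ (-θ) : ℝ) * I) = 1 := by
    intro θ
    have h1 : (‖f θ‖ : ℂ) ≠ 0 := by exact_mod_cast norm_ne_zero_iff.2 (hf θ)
    have h2 := hψ.2 (-θ)
    rw [hconj, norm_conj] at h2
    nth_rw 1 [hψ.2 θ] at h2
    rw [map_mul, conj_ofReal, ← Complex.exp_conj, map_mul, conj_ofReal, conj_I] at h2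
    have h3 := mul_left_cancel₀ h1 h2
    rw [ofReal_add, add_mul, Complex.exp_add, ← h3, ← Complex.exp_add]
    simp
  have hint : ∀ θ, ∃ k : ℤ, ψ θ + ψ (-θ) = 2 * Real.pi * k := by
    intro θ
    obtain ⟨k, hk⟩ := Complex.exp_eq_one_iff.1 (hexp θ)
    refine ⟨k, ?_⟩
    have h1 : ((ψ θ + ψ (-θ) : ℝ) : ℂ) = ((k * (2 * Real.pi) : ℝ) : ℂ) := by
      apply mul_right_cancel₀ I_ne_zero
      rw [hk]
      push_cast
      ring
    rw [ofReal_inj] at h1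
    linarith
  have hcont := hψ.1
  -- The sum ψ(θ) + ψ(-θ) is continuous with values in 2πℤ, hence constant. The interval (-1, 4)
  -- serves only because it contains 0 and π.
  obtain ⟨j, hj⟩ := exists_int_of_cos_pos (β := fun θ => ψ θ + ψ (-θ)) (by fun_prop)
    (show (-1 : ℝ) < 4 by norm_num) (fun θ _ => by
      have h1 := congrArg re (hexp θ)
      rw [exp_ofReal_mul_I_re] at h1
      rw [h1]
      norm_num)
  have hconst : ∀ θ ∈ Set.Icc (-1 : ℝ) 4, ψ θ + ψ (-θ) = 2 * Real.pi * j := by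
    intro θ hθ
    obtain ⟨k, hk⟩ := hint θ
    have h1 := abs_le.1 (hj θ hθ)
    simp only [hk] at h1
    have h2 : k = j := by
      have h3 : (k : ℝ) - j < 1 := by nlinarith
      have h4 : -1 < (k : ℝ) - j := by nlinarith
      have h5 : k - j < 1 := by exact_mod_cast h3
      have h6 : -1 < k - j := by exact_mod_cast h4
      omega
    rw [hk, h2]
  have e0 := hconst 0 (by norm_num)
  have e1 := hconst Real.pi ⟨by linarith, Real.pi_le_four⟩
  have e2 := hN (-Real.pi)
  rw [neg_zero] at e0
  rw [show -Real.pi + 2 * Real.pi = Real.pi by ring] at e2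
  linarith

end IsPhase

/-! ### Dominating blocks and nonvanishing on the unit circle -/

section PatternPoly

open Complex

lemma eval_map_patternPoly (m l : ℕ) (z : ℂ) :
    ((patternPoly m l).map (Int.castRingHom ℂ)).eval z =
      (1 - z + z ^ 2) * ∑ i ∈ Finset.range m, (z ^ 3) ^ i + z ^ (3 * m)
        - z ^ (3 * m + 1) * ∑ j ∈ Finset.range l, z ^ j := by
  simp [patternPoly, Polynomial.map_sum, eval_finsetSum]

lemma eval_map_patternPoly_conj (m l : ℕ) (z : ℂ) :
    ((patternPoly m l).map (Int.castRingHom ℂ)).eval ((starRingEnd ℂ) z) =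
      (starRingEnd ℂ) (((patternPoly m l).map (Int.castRingHom ℂ)).eval z) := by
  simp [eval_map_patternPoly]

/-- Multiplying by `1 - z ^ 3` leaves a polynomial with three short blocks. -/
lemma eval_map_patternPoly_mul (m l : ℕ) (z : ℂ) :
    ((patternPoly m l).map (Int.castRingHom ℂ)).eval z * (1 - z ^ 3) =
      (1 - z + z ^ 2) - 2 * z ^ (3 * m + 2) * (1 + z)
        + z ^ (3 * m + l + 1) * (1 + z + z ^ 2) := by
  have h1 := geom_sum_mul (z ^ 3) m
  have h2 := geom_sum_mul z l
  rw [eval_map_patternPoly]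
  rw [← pow_mul] at h1
  linear_combination (-(1 - z + z ^ 2)) * h1 + z ^ (3 * m + 1) * (1 + z + z ^ 2) * h2

lemma eval_map_patternPoly_one (m l : ℕ) :
    ((patternPoly m l).map (Int.castRingHom ℂ)).eval 1 = ((m + 1 - l : ℝ) : ℂ) := by
  rw [eval_map_patternPoly]
  simp

lemma eval_map_patternPoly_neg_one (m l : ℕ) :
    ∃ r : ℝ, 0 < r ∧ ((patternPoly m l).map (Int.castRingHom ℂ)).eval (-1) = r := by
  have h := eval_map_patternPoly_mul m l (-1)
  set y := ((patternPoly m l).map (Int.castRingHom ℂ)).eval (-1)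
  have h2 : y = ((3 + (-1) ^ (3 * m + l + 1)) / 2 : ℝ) := by
    push_cast
    linear_combination h / 2
  refine ⟨_, ?_, h2⟩
  rcases neg_one_pow_eq_or ℝ (3 * m + l + 1) with h | h <;> rw [h] <;> norm_num

lemma sum_range_pow_of_sq_add_self_add_one {z : ℂ} (hz : z ^ 2 + z + 1 = 0) (l : ℕ) :
    (z ^ l = 1 ∧ z * ∑ j ∈ Finset.range l, z ^ j = 0) ∨
    (z ^ l = z ∧ z * ∑ j ∈ Finset.range l, z ^ j = z) ∨
    (z ^ l = z ^ 2 ∧ z * ∑ j ∈ Finset.range l, z ^ j = -1) := by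
  induction l with
  | zero => simp
  | succ l ih =>
    rw [pow_succ, Finset.sum_range_succ, mul_add]
    rcases ih with ⟨h1, h2⟩ | ⟨h1, h2⟩ | ⟨h1, h2⟩ <;> rw [h1, h2]
    · right; left
      constructor <;> ring
    · right; right
      constructor
      · ring
      · linear_combination hz
    · left
      constructor <;> linear_combination (z - 1) * hz

/-- At a primitive cube root of unity 1 - z^3 vanishes and the three-block identity says nothing.
Direct evaluation gives real part at least m + 1. -/
lemma eval_map_patternPoly_ne_zero_of_sq_add_self_add_one {z : ℂ} (hz : z ^ 2 + z + 1 = 0)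
    (hre : z.re = -1 / 2) (m l : ℕ) :
    ((patternPoly m l).map (Int.castRingHom ℂ)).eval z ≠ 0 := by
  have h3 : z ^ 3 = 1 := by linear_combination (z - 1) * hz
  have h : ((patternPoly m l).map (Int.castRingHom ℂ)).eval z =
      1 - 2 * z * m - z * ∑ j ∈ Finset.range l, z ^ j := by
    rw [eval_map_patternPoly, pow_add, pow_mul, h3]
    simp only [one_pow, one_mul, pow_one, Finset.sum_const, Finset.card_range, nsmul_eq_mul]
    linear_combination (m : ℂ) * hz
  intro h0
  rw [h] at h0
  have hm : (0 : ℝ) ≤ m := m.cast_nonneg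
  have hr := congrArg re h0
  rcases sum_range_pow_of_sq_add_self_add_one hz l with h2 | h2 | h2 <;> rw [h2.2] at hr <;>
    simp [hre] at hr <;> linarith

/-- `4 * cos (θ / 2)` dominates when `cos θ > -1 / 2`, with `x = cos (θ / 2)`. -/
lemma abs_add_abs_lt_four_mul {x : ℝ} (h1 : 1 / 2 < x) (h2 : x < 1) :
    |2 * (2 * x ^ 2 - 1) - 1| + |2 * (2 * x ^ 2 - 1) + 1| < 4 * x := by
  have h3 : 0 ≤ 2 * (2 * x ^ 2 - 1) + 1 := by nlinarith
  rw [abs_of_nonneg h3]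
  rcases abs_cases (2 * (2 * x ^ 2 - 1) - 1) with ⟨h, _⟩ | ⟨h, _⟩ <;> rw [h] <;> nlinarith

lemma re_mul_le_abs {a : ℝ} {v : ℂ} (hv : ‖v‖ = 1) : ((a : ℂ) * v).re ≤ |a| := by
  refine (re_le_norm _).trans ?_
  rw [norm_mul, hv, mul_one, norm_real, Real.norm_eq_abs]

lemma exp_half_identities (θ : ℝ) :
    cexp (θ * I) = cexp ((θ / 2 : ℝ) * I) ^ 2 ∧
    ((2 * Real.cos (θ / 2) : ℝ) : ℂ) = cexp ((θ / 2 : ℝ) * I) + (cexp ((θ / 2 : ℝ) * I))⁻¹ ∧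
    ((2 * Real.sin (3 * θ / 2) : ℝ) : ℂ) * I =
      cexp ((θ / 2 : ℝ) * I) ^ 3 - (cexp ((θ / 2 : ℝ) * I))⁻¹ ^ 3 := by
  refine ⟨?_, ?_, ?_⟩
  · rw [← Complex.exp_nat_mul]
    congr 1
    push_cast
    ring
  · rw [← Complex.exp_neg]
    push_cast
    rw [Complex.two_cos]
    ring_nf
  · rw [← Complex.exp_neg, ← Complex.exp_nat_mul, ← Complex.exp_nat_mul]
    push_cast
    rw [Complex.two_sin]
    ring_nf
    rw [I_sq]
    ring_nf

/-- On the arc where the middle block dominates. -/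
lemma re_eval_pos_of_mid {m l : ℕ} {θ : ℝ} (h0 : 0 < θ) (h1 : θ < 2 * Real.pi / 3) :
    0 < ((((patternPoly m l).map (Int.castRingHom ℂ)).eval (cexp (θ * I))) *
      (cexp ((θ / 2 : ℝ) * I))⁻¹ ^ (6 * m + 2) * I).re := by
  obtain ⟨e1, e2, e3⟩ := exp_half_identities θ
  have hid := eval_map_patternPoly_mul m l (cexp (θ * I))
  set y := ((patternPoly m l).map (Int.castRingHom ℂ)).eval (cexp (θ * I))
  set w := cexp ((θ / 2 : ℝ) * I) with hw
  have hw1 : ‖w‖ = 1 := norm_exp_ofReal_mul_I _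
  have hw0 : w ≠ 0 := Complex.exp_ne_zero _
  set x := Real.cos (θ / 2) with hx
  have hx1 : 1 / 2 < x := by
    rw [← Real.cos_pi_div_three]
    exact Real.cos_lt_cos_of_nonneg_of_le_pi (by linarith) (by linarith) (by linarith)
  have hx2 : x < 1 := by
    rw [← Real.cos_zero]
    exact Real.cos_lt_cos_of_nonneg_of_le_pi le_rfl (by linarith) (by linarith)
  have hs : 0 < Real.sin (3 * θ / 2) := Real.sin_pos_of_pos_of_lt_pi (by linarith) (by linarith)
  -- With z = w^2, one has 1 - z^3 = -2i sin(3θ/2) w^3 and 1 + z = 2xw. The rotation makes the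
  -- middle block the positive real 4x; the others are 2cos θ ∓ 1 times unimodular numbers.
  have key : (y * w⁻¹ ^ (6 * m + 2) * I) * ((2 * Real.sin (3 * θ / 2) : ℝ) : ℂ) =
      ((4 * x : ℝ) : ℂ) - ((2 * (2 * x ^ 2 - 1) - 1 : ℝ) : ℂ) * w⁻¹ ^ (6 * m + 3)
        - ((2 * (2 * x ^ 2 - 1) + 1 : ℝ) : ℂ) * (w ^ (2 * l) * w⁻¹) := by
    have hc : ((2 * (2 * x ^ 2 - 1) : ℝ) : ℂ) = w ^ 2 + w⁻¹ ^ 2 := by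
      have : ((2 * (2 * x ^ 2 - 1) : ℝ) : ℂ) = ((2 * x : ℝ) : ℂ) ^ 2 - 2 := by push_cast; ring
      rw [this, e2]
      field_simp
      ring
    rw [mul_assoc, mul_comm I, e3, ofReal_sub, ofReal_add, hc,
      show ((4 * x : ℝ) : ℂ) = 2 * ((2 * x : ℝ) : ℂ) by push_cast; ring, e2]
    rw [e1] at hid
    have hid' : y * w⁻¹ ^ (6 * m + 2) * (w ^ 3 - w⁻¹ ^ 3) =
        -(y * (1 - (w ^ 2) ^ 3)) * w⁻¹ ^ (6 * m + 5) := by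
      simp only [inv_pow]
      field_simp
      ring
    rw [hid', hid]
    push_cast
    simp only [inv_pow]
    field_simp
    ring
  have hre := congrArg re key
  rw [re_mul_ofReal, sub_re, sub_re, ofReal_re] at hre
  have b1 := re_mul_le_abs (a := 2 * (2 * x ^ 2 - 1) - 1) (v := w⁻¹ ^ (6 * m + 3)) (by simp [hw1])
  have b2 := re_mul_le_abs (a := 2 * (2 * x ^ 2 - 1) + 1) (v := w ^ (2 * l) * w⁻¹) (by simp [hw1])
  have b3 := abs_add_abs_lt_four_mul hx1 hx2
  exact pos_of_mul_pos_left (b := 2 * Real.sin (3 * θ / 2)) (by linarith) (by linarith)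

/-- On the arc where the lowest block dominates. -/
lemma re_eval_pos_of_low {m l : ℕ} {θ : ℝ} (h0 : 2 * Real.pi / 3 < θ) (h1 : θ ≤ Real.pi) :
    0 < ((((patternPoly m l).map (Int.castRingHom ℂ)).eval (cexp (θ * I))) *
      cexp ((θ / 2 : ℝ) * I) * -I).re := by
  have hpi := Real.pi_pos
  obtain ⟨e1, e2, e3⟩ := exp_half_identities θ
  have hid := eval_map_patternPoly_mul m l (cexp (θ * I))
  set y := ((patternPoly m l).map (Int.castRingHom ℂ)).eval (cexp (θ * I))
  set w := cexp ((θ / 2 : ℝ) * I) with hw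
  have hw1 : ‖w‖ = 1 := norm_exp_ofReal_mul_I _
  have hw0 : w ≠ 0 := Complex.exp_ne_zero _
  set x := Real.cos (θ / 2) with hx
  have hx1 : x < 1 / 2 := by
    rw [← Real.cos_pi_div_three]
    exact Real.cos_lt_cos_of_nonneg_of_le_pi (by linarith) (by linarith) (by linarith)
  have hx2 : 0 ≤ x := Real.cos_nonneg_of_neg_pi_div_two_le_of_le (by linarith) (by linarith)
  have hs : Real.sin (3 * θ / 2) < 0 := by
    rw [← neg_pos, ← Real.sin_sub_pi]
    exact Real.sin_pos_of_pos_of_lt_pi (by linarith) (by linarith)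
  -- Now the lowest block is rotated to the real number 2cos θ - 1. It is negative and dominates,
  -- and sin(3θ/2) is negative too, so the quotient has positive real part.
  have key : (y * w * -I) * ((2 * Real.sin (3 * θ / 2) : ℝ) : ℂ) =
      ((2 * (2 * x ^ 2 - 1) - 1 : ℝ) : ℂ) + ((-(4 * x) : ℝ) : ℂ) * w ^ (6 * m + 3)
        + ((2 * (2 * x ^ 2 - 1) + 1 : ℝ) : ℂ) * w ^ (6 * m + 2 * l + 2) := by
    have hc : ((2 * (2 * x ^ 2 - 1) : ℝ) : ℂ) = w ^ 2 + w⁻¹ ^ 2 := by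
      have : ((2 * (2 * x ^ 2 - 1) : ℝ) : ℂ) = ((2 * x : ℝ) : ℂ) ^ 2 - 2 := by push_cast; ring
      rw [this, e2]
      field_simp
      ring
    rw [mul_assoc, neg_mul, mul_comm I, e3, ofReal_sub, ofReal_add, hc,
      show ((-(4 * x) : ℝ) : ℂ) = -2 * ((2 * x : ℝ) : ℂ) by push_cast; ring, e2]
    rw [e1] at hid
    have hid' : y * w * -(w ^ 3 - w⁻¹ ^ 3) = y * (1 - (w ^ 2) ^ 3) * w⁻¹ ^ 2 := by
      field_simp
      ring
    rw [hid', hid]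
    push_cast
    simp only [inv_pow]
    field_simp
    ring
  have hre := congrArg re key
  rw [re_mul_ofReal, add_re, add_re, ofReal_re] at hre
  have b1 := re_mul_le_abs (a := -(4 * x)) (v := w ^ (6 * m + 3)) (by simp [hw1])
  have b2 := re_mul_le_abs (a := 2 * (2 * x ^ 2 - 1) + 1) (v := w ^ (6 * m + 2 * l + 2))
    (by simp [hw1])
  rw [abs_neg, abs_of_nonneg (by linarith)] at b1
  rw [abs_of_nonpos (by nlinarith)] at b2
  by_contra! hc
  have := mul_nonneg_of_nonpos_of_nonpos hc hs.le
  linarith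

lemma eval_map_patternPoly_exp_ne_zero {m l : ℕ} (hml : l ≠ m + 1) {θ : ℝ} (h0 : 0 ≤ θ)
    (h1 : θ ≤ Real.pi) :
    ((patternPoly m l).map (Int.castRingHom ℂ)).eval (cexp (θ * I)) ≠ 0 := by
  rcases h0.eq_or_lt with rfl | h0
  · rw [ofReal_zero, zero_mul, Complex.exp_zero, eval_map_patternPoly_one, ofReal_ne_zero]
    intro h
    exact hml (by exact_mod_cast (sub_eq_zero.1 h).symm)
  rcases lt_trichotomy θ (2 * Real.pi / 3) with h | h | h
  · intro h2
    have := re_eval_pos_of_mid (m := m) (l := l) h0 h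
    simp [h2] at this
  · have hre : (cexp (θ * I)).re = -1 / 2 := by
      rw [exp_ofReal_mul_I_re, h, show 2 * Real.pi / 3 = Real.pi - Real.pi / 3 by ring,
        Real.cos_pi_sub, Real.cos_pi_div_three]
      norm_num
    refine eval_map_patternPoly_ne_zero_of_sq_add_self_add_one ?_ hre m l
    have h2 : cexp (θ * I) * (starRingEnd ℂ) (cexp (θ * I)) = 1 := by
      rw [mul_conj, normSq_eq_norm_sq, norm_exp_ofReal_mul_I]
      norm_num
    have h3 := add_conj (cexp (θ * I))
    rw [hre] at h3
    push_cast at h3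
    linear_combination cexp (θ * I) * h3 - h2
  · intro h2
    have := re_eval_pos_of_low (m := m) (l := l) h h1
    simp [h2] at this

lemma eval_map_patternPoly_ne_zero {m l : ℕ} (hml : l ≠ m + 1) {z : ℂ} (hz : ‖z‖ = 1) :
    ((patternPoly m l).map (Int.castRingHom ℂ)).eval z ≠ 0 := by
  have h1 : z = cexp (arg z * I) := by
    have := norm_mul_exp_arg_mul_I z
    rw [hz, ofReal_one, one_mul] at this
    exact this.symm
  rcases le_total 0 (arg z) with h | h
  · rw [h1]
    exact eval_map_patternPoly_exp_ne_zero hml h (arg_le_pi z)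
  · have h2 := eval_map_patternPoly_exp_ne_zero hml (neg_nonneg.2 h)
      (neg_le.1 (neg_pi_lt_arg z).le)
    have h3 : cexp ((-arg z : ℝ) * I) = (starRingEnd ℂ) z := by
      nth_rw 2 [h1]
      rw [← Complex.exp_conj]
      simp
    rwa [h3, eval_map_patternPoly_conj, Ne, map_eq_zero] at h2

lemma numUnimodularZeros_patternPoly {m l : ℕ} (hml : l ≠ m + 1) :
    numUnimodularZeros (patternPoly m l) = 0 := by
  rw [numUnimodularZeros, Multiset.countP_eq_zero]
  exact fun z hz h => eval_map_patternPoly_ne_zero hml h (isRoot_of_mem_roots hz)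

end PatternPoly

/-! ### Counting the zeros in the disk -/

section PatternPoly

open Complex

lemma eq_zero_of_abs_two_pi_mul_int_lt {k : ℤ} (h : |2 * Real.pi * k| < 2 * Real.pi) : k = 0 := by
  have hpi := Real.pi_pos
  rw [abs_mul, abs_of_pos (by positivity)] at h
  have h1 : |(k : ℝ)| < 1 := by nlinarith
  exact Int.abs_lt_one_iff.1 (by exact_mod_cast h1)

lemma numZerosInDisk_patternPoly_eq {m l : ℕ} (hml : l ≠ m + 1) :
    numZerosInDisk (patternPoly m l) = if l ≤ m then 2 * m else 2 * m + 1 := by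
  have hpi := Real.pi_pos
  obtain ⟨ψ, hψ, hN⟩ := IsPhase.exists_polynomial ((patternPoly m l).map (Int.castRingHom ℂ))
    fun z hz => eval_map_patternPoly_ne_zero hml hz
  have hne : ∀ θ : ℝ, ((patternPoly m l).map (Int.castRingHom ℂ)).eval (cexp (θ * I)) ≠ 0 :=
    fun θ => eval_map_patternPoly_ne_zero hml (norm_exp_ofReal_mul_I θ)
  have hwind := hψ.sub_eq_pi_mul hne (fun θ => by
    rw [← eval_map_patternPoly_conj, ← Complex.exp_conj]
    simp) hN
  rw [← numZerosInDisk] at hwind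
  have hcont := hψ.1
  have hphase := hψ.2
  beta_reduce at hphase
  -- the phase on the arc from `1` to the primitive cube root of unity
  obtain ⟨j, hj⟩ := IsPhase.exists_int_of_cos_pos
    (β := fun θ => ψ θ - ((3 * m + 1) * θ + 3 * Real.pi / 2)) (by fun_prop)
    (show 0 < 2 * Real.pi / 3 by positivity) (fun θ hθ => by
      have h := re_eval_pos_of_mid (m := m) (l := l) hθ.1 hθ.2
      rw [hphase θ, mul_assoc, mul_assoc, re_ofReal_mul] at h
      have h1 := pos_of_mul_pos_right h (norm_nonneg _)
      rw [← exp_ofReal_mul_I_re]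
      refine h1.trans_eq (congrArg re ?_)
      rw [← Complex.exp_neg, ← Complex.exp_nat_mul]
      -- The middle block gives h the phase of -i e^{i(3m+1)θ}; the representative 3π/2 for -i
      -- matches the offset in β.
      have hI : I = cexp (-(3 * Real.pi / 2 : ℝ) * I) := by
        rw [show -((3 * Real.pi / 2 : ℝ) : ℂ) * I = Real.pi / 2 * I - 2 * Real.pi * I by
          push_cast; ring, Complex.exp_sub, Complex.exp_pi_div_two_mul_I, Complex.exp_two_pi_mul_I,
          div_one]
      conv_lhs => enter [2, 2]; rw [hI]
      rw [← Complex.exp_add, ← Complex.exp_add]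
      congr 1
      push_cast
      ring)
  obtain ⟨j', hj'⟩ := IsPhase.exists_int_of_cos_pos
    (β := fun θ => ψ θ - (Real.pi / 2 - θ / 2)) (by fun_prop)
    (show 2 * Real.pi / 3 < Real.pi by linarith) (fun θ hθ => by
      have h := re_eval_pos_of_low (m := m) (l := l) hθ.1 hθ.2.le
      rw [hphase θ, mul_assoc, mul_assoc, re_ofReal_mul] at h
      have h1 := pos_of_mul_pos_right h (norm_nonneg _)
      rw [← exp_ofReal_mul_I_re]
      refine h1.trans_eq (congrArg re ?_)
      have hI : -I = cexp (-(Real.pi / 2 : ℝ) * I) := by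
        rw [neg_mul, Complex.exp_neg, ofReal_div, ofReal_ofNat, Complex.exp_pi_div_two_mul_I, inv_I]
      rw [hI, ← Complex.exp_add, ← Complex.exp_add]
      congr 1
      push_cast
      ring)
  have a0 := abs_le.1 (hj 0 ⟨le_rfl, by positivity⟩)
  have a1 := abs_le.1 (hj (2 * Real.pi / 3) ⟨by positivity, le_rfl⟩)
  have a2 := abs_le.1 (hj' (2 * Real.pi / 3) ⟨le_rfl, by linarith⟩)
  have a3 := abs_le.1 (hj' Real.pi ⟨by linarith, le_rfl⟩)
  simp only [mul_zero, zero_add] at a0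
  -- compare the two arcs at the cube root of unity
  have hjj : j' = j + m + 1 := by
    -- At 2π/3 the two reference phases differ by 2π(j' - (j + m + 1)). Since ψ is within π/2 of
    -- both, this is at most π in absolute value.
    have : j' - (j + m + 1) = 0 := by
      apply eq_zero_of_abs_two_pi_mul_int_lt
      push_cast
      rw [abs_lt]
      constructor <;> nlinarith
    omega
  -- At θ = 0 and θ = π the value is real, so its sign gives ψ modulo 2π, and the π/2 bounds then
  -- select the multiple.
  have hcosπ : Real.cos (ψ Real.pi) = 1 := by
    obtain ⟨r, hr, h⟩ := eval_map_patternPoly_neg_one m l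
    have h1 := hψ.abs_mul_cos (θ := Real.pi) (r := r) (by rw [Complex.exp_pi_mul_I, h])
    rw [abs_of_pos hr] at h1
    exact (mul_eq_left₀ hr.ne').1 h1
  have hcos0 : Real.cos (ψ 0) = if l ≤ m then 1 else -1 := by
    have h1 := hψ.abs_mul_cos (θ := 0) (r := m + 1 - l)
      (by rw [ofReal_zero, zero_mul, Complex.exp_zero, eval_map_patternPoly_one])
    split_ifs with h
    · have hr : (0 : ℝ) < m + 1 - l := by
        have : (l : ℝ) ≤ m := by exact_mod_cast h
        linarith
      rw [abs_of_pos hr] at h1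
      exact (mul_eq_left₀ hr.ne').1 h1
    · have hr : (m : ℝ) + 1 - l < 0 := by
        have : (m : ℝ) + 2 ≤ l := by exact_mod_cast (by omega : m + 2 ≤ l)
        linarith
      rw [abs_of_neg hr] at h1
      exact mul_left_cancel₀ hr.ne (by linarith)
  have hψπ : ψ Real.pi = 2 * Real.pi * (j + m + 1) := by
    obtain ⟨k, hk⟩ := (Real.cos_eq_one_iff _).1 hcosπ
    have : k - j' = 0 := by
      apply eq_zero_of_abs_two_pi_mul_int_lt
      push_cast
      rw [abs_lt]
      constructor <;> linarith
    obtain rfl : k = j + m + 1 := by omega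
    rw [← hk]
    push_cast
    ring
  split_ifs at hcos0 ⊢ with h
  · obtain ⟨k, hk⟩ := (Real.cos_eq_one_iff _).1 hcos0
    have : k - (j + 1) = 0 := by
      apply eq_zero_of_abs_two_pi_mul_int_lt
      push_cast
      rw [abs_lt]
      constructor <;> linarith
    obtain rfl : k = j + 1 := by omega
    have hfin : Real.pi * (numZerosInDisk (patternPoly m l)) = Real.pi * (2 * m) := by
      rw [← hwind, hψπ, ← hk]
      push_cast
      ring
    exact_mod_cast mul_left_cancel₀ hpi.ne' hfin
  · obtain ⟨k, hk⟩ := Real.cos_eq_neg_one_iff.1 hcos0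
    have : k - j = 0 := by
      apply eq_zero_of_abs_two_pi_mul_int_lt
      push_cast
      rw [abs_lt]
      constructor <;> linarith
    obtain rfl : k = j := by omega
    have hfin : Real.pi * (numZerosInDisk (patternPoly m l)) = Real.pi * (2 * m + 1) := by
      rw [← hwind, hψπ, ← hk]
      ring
    exact_mod_cast mul_left_cancel₀ hpi.ne' hfin

end PatternPoly

theorem corollary2p9 (n : ℕ) (hn : 2 ≤ n) (k : ℕ)
    (hk : (Even k ∧ (n : ℝ) / 2 ≤ (k : ℝ) ∧ (k : ℝ) ≤ 2 * (n : ℝ) / 3) ∨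
      (Odd k ∧ 3 ≤ k ∧ (k : ℝ) ≤ (n : ℝ) / 2)) :
    ∃ m l : ℕ, 1 ≤ m ∧ l + 3 * m = n ∧
      patternPoly m l ∈ littlewoodPolys n ∧
      numZerosInDisk (patternPoly m l) = k ∧
      numUnimodularZeros (patternPoly m l) = 0 := by
  obtain ⟨m, l, hm, hn', hml, hk'⟩ : ∃ m l : ℕ, 1 ≤ m ∧ l + 3 * m = n ∧ l ≠ m + 1 ∧
      (if l ≤ m then 2 * m else 2 * m + 1) = k := by
    rcases hk with ⟨⟨m, rfl⟩, h1, h2⟩ | ⟨⟨m, rfl⟩, h1, h2⟩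
    -- With k = 2m and l = n - 3m, the condition l ≤ m is n ≤ 2k and l ≥ 0 is k ≤ 2n/3.
    · have h1' : n ≤ 2 * (m + m) := by
        have : (n : ℝ) ≤ 2 * (m + m : ℕ) := by linarith
        exact_mod_cast this
      have h2' : 3 * (m + m) ≤ 2 * n := by
        have : (3 : ℝ) * (m + m : ℕ) ≤ 2 * n := by linarith
        exact_mod_cast this
      refine ⟨m, n - 3 * m, by omega, by omega, by omega, ?_⟩
      rw [if_pos (by omega)]
      ring
    -- With k = 2m + 1, the condition 2k ≤ n is exactly l ≥ m + 2, which also avoids the zero at z =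
    -- 1; k ≥ 3 gives m ≥ 1.
    · have h2' : 2 * (2 * m + 1) ≤ n := by
        have : (2 : ℝ) * (2 * m + 1 : ℕ) ≤ n := by linarith
        exact_mod_cast this
      refine ⟨m, n - 3 * m, by omega, by omega, by omega, ?_⟩
      rw [if_neg (by omega)]
  refine ⟨m, l, hm, hn', hn' ▸ patternPoly_mem_littlewoodPolys m l, ?_,
    numUnimodularZeros_patternPoly hml⟩
  rw [numZerosInDisk_patternPoly_eq hml, hk']
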